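/- \textbf{Theorem.} For a field $k$ and a finite group $G$, let $G$ act on the rational function field $k(x_g : g\in G)$ by $k$-automorphisms with $g\cdot x_h=x_{gh}$ for all $g,h\in G$, and let $k(G)=k(x_g:g\in G)^G$ be the fixed field. For $k$ infinite, an extension field $K$ of $k$ is called \emph{retract $k$-rational} if there are a $k$-subalgebra $A\subseteq K$ with quotient field $K$, a nonzero polynomial $f\in k[X_1,\dots,X_n]$ (for some $n$), and $k$-algebra homomorphisms $\varphi\colon A\to k[X_1,\dots,X_n][1/f]$ and $\psi\colon k[X_1,\dots,X_n][1/f]\to A$ with $\psi\circ\varphi=1_A$. We say that \emph{Hilbert's irreducibility theorem is valid for $k$} if for every $n\ge 0$, every polynomial $P\in k[T_1,\dots,T_n][X]$ that is irreducible and separable as a polynomial in $X$ over $k(T_1,\dots,T_n)$, and every nonzero $q\in k[T_1,\dots,T_n]$, there is a point $t\in k^n$ with $q(t)\ne 0$ such that $P(t,X)$ is irreducible in $k[X]$. Let $G$ be a finite group and let $k$ be an infinite field for which Hilbert's irreducibility theorem is valid. If $k(G)$ is retract $k$-rational, then there is a finite Galois extension $K$ of $k$ whose Galois group is isomorphic to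 $G$. -/

import Mathlib

universe u v

/-- The permutation action of `G` on the polynomial ring `k[x_g : g ∈ G]`,
`g · x_h = x_{g h}`. -/
noncomputable def noetherPolyAction (k : Type*) (G : Type*) [Field k] [Group G] :
    G →* (MvPolynomial G k ≃ₐ[k] MvPolynomial G k) where
  toFun g := MvPolynomial.renameEquiv k (Equiv.mulLeft g)
  map_one' := by
    refine AlgEquiv.ext fun p => ?_
    simp
  map_mul' a b := by
    refine AlgEquiv.ext fun p => ?_
    simp [MvPolynomial.rename_rename, Equiv.Perm.coe_mul]

/-- The induced action of `G` on the rational function field `k(x_g : g ∈ G)` by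
`k`-automorphisms. -/
noncomputable def noetherAction (k : Type*) (G : Type*) [Field k] [Group G] :
    G →* (FractionRing (MvPolynomial G k) ≃ₐ[k] FractionRing (MvPolynomial G k)) :=
  (IsFractionRing.fieldEquivOfAlgEquivHom k (FractionRing (MvPolynomial G k))).comp
    (noetherPolyAction k G)

theorem noetherAction_X (k : Type*) (G : Type*) [Field k] [Group G] (g h : G) :
    noetherAction k G g (algebraMap (MvPolynomial G k) _ (MvPolynomial.X h)) =
      algebraMap (MvPolynomial G k) _ (MvPolynomial.X (g * h)) := by
  simp [noetherAction, noetherPolyAction]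

/-- The field `k(G) = k(x_g : g ∈ G)^G`. -/
noncomputable def noetherField (k : Type*) (G : Type*) [Field k] [Group G] :
    IntermediateField k (FractionRing (MvPolynomial G k)) :=
  IntermediateField.fixedField (noetherAction k G).range

/-- `K` is retract `k`-rational (a notion used for infinite `k`): some `k`-subalgebra `A` of `K`
has quotient field `K` and is a retract, in the category of `k`-algebras, of a localized
polynomial ring `k[X₁, …, Xₙ][1/f]` with `f ≠ 0`. -/
def IsRetractRational (k : Type*) (K : Type*) [Field k] [Field K] [Algebra k K] : Prop :=
  ∃ A : Subalgebra k K, IsFractionRing A K ∧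
    ∃ (n : ℕ) (f : MvPolynomial (Fin n) k), f ≠ 0 ∧
      ∃ (φ : A →ₐ[k] Localization.Away f) (ψ : Localization.Away f →ₐ[k] A),
        ψ.comp φ = AlgHom.id k A

/-- Hilbert's irreducibility theorem holds for `k`: if `P(T₁, …, Tₙ, X)` is irreducible and
separable as a polynomial in `X` over `k(T₁, …, Tₙ)`, then the points `t ∈ kⁿ` for which
`P(t, X)` is irreducible in `k[X]` are Zariski dense in affine `n`-space, that is, every
nonzero polynomial `q` is nonzero at one of them. (In characteristic zero, separability
follows from irreducibility.) -/
def HilbertIrreducibilityHolds (k : Type*) [Field k] : Prop :=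
  ∀ (n : ℕ) (P : Polynomial (MvPolynomial (Fin n) k)),
    Irreducible (P.map (algebraMap _ (FractionRing (MvPolynomial (Fin n) k)))) →
    (P.map (algebraMap _ (FractionRing (MvPolynomial (Fin n) k)))).Separable →
    ∀ q : MvPolynomial (Fin n) k, q ≠ 0 →
      ∃ t : Fin n → k, MvPolynomial.eval t q ≠ 0 ∧
        Irreducible (P.map (MvPolynomial.eval t))

/-! The field `k(x_g)` is Galois over `k(G)` with group `G`. The minimal polynomial `Q` of a
primitive element, with polynomials `ρ g` giving its conjugates, encodes this in finitely many
identities (`IsGaloisResolvent`). These survive every homomorphism to a nontrivial ring, and over a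
field an irreducible `Q` recovers a `G`-extension. So only irreducibility has to be carried from
`k(G)` to `k`: retract rationality carries it to some `k(T₁, …, Tₙ)`
(`IsRetractRational.exists_ringHom`), and Hilbert's theorem from there to `k`
(`HilbertIrreducibilityHolds.exists_resolvent`). -/

/-! ### Galois extensions as polynomial identities -/

open Polynomial in
/-- `Q` is a monic polynomial of degree `|G|` whose root `x` in `R[X]/(Q)` has conjugates
`ρ g (x)`, `g ∈ G`, on which the composition of substitutions is the multiplication of `G` and
which differ from `x` by units for `g ≠ 1`. -/
structure IsGaloisResolvent {R : Type*} {G : Type*} [CommRing R] [Group G]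
    (Q : R[X]) (ρ : G → R[X]) : Prop where
  monic : Q.Monic
  natDegree_eq : Q.natDegree = Nat.card G
  dvd_comp : ∀ g, Q ∣ Q.comp (ρ g)
  dvd_one : Q ∣ ρ 1 - X
  dvd_mul : ∀ g h, Q ∣ (ρ h).comp (ρ g) - ρ (g * h)
  isCoprime : ∀ g, g ≠ 1 → IsCoprime (ρ g - X) Q

namespace IsGaloisResolvent

open Polynomial

variable {R S G : Type*} [CommRing R] [CommRing S] [Group G] {Q : R[X]} {ρ : G → R[X]}

theorem map [Nontrivial S] (H : IsGaloisResolvent Q ρ) (f : R →+* S) :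
    IsGaloisResolvent (Q.map f) fun g => (ρ g).map f where
  monic := H.monic.map f
  natDegree_eq := by rw [H.monic.natDegree_map, H.natDegree_eq]
  dvd_comp g := by
    simpa [Polynomial.map_comp] using Polynomial.map_dvd f (H.dvd_comp g)
  dvd_one := by simpa using Polynomial.map_dvd f H.dvd_one
  dvd_mul g h := by
    simpa [Polynomial.map_comp] using Polynomial.map_dvd f (H.dvd_mul g h)
  isCoprime g hg := by simpa using (H.isCoprime g hg).map (Polynomial.mapRingHom f)

/-- A resolvent descends along an injective homomorphism as soon as the polynomials and the
Bézout coefficients do. -/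
theorem of_map {f : R →+* S} (hf : Function.Injective f)
    (H : IsGaloisResolvent (Q.map f) fun g => (ρ g).map f) (a b : G → R[X])
    (hab : ∀ g, g ≠ 1 → (a g).map f * ((ρ g).map f - X) + (b g).map f * Q.map f = 1) :
    IsGaloisResolvent Q ρ := by
  have hQ : Q.Monic := Polynomial.monic_of_injective hf H.monic
  refine ⟨hQ, ?_, fun g => ?_, ?_, fun g h => ?_, fun g hg => ⟨a g, b g, ?_⟩⟩
  · rw [← Polynomial.natDegree_map_eq_of_injective hf, H.natDegree_eq]
  -- Division by a monic polynomial commutes with base change, so divisibility descends without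
  -- denominators.
  · rw [← Polynomial.map_dvd_map f hf hQ, Polynomial.map_comp]
    exact H.dvd_comp g
  · rw [← Polynomial.map_dvd_map f hf hQ]
    simpa using H.dvd_one
  · rw [← Polynomial.map_dvd_map f hf hQ, Polynomial.map_sub, Polynomial.map_comp]
    exact H.dvd_mul g h
  · apply Polynomial.map_injective f hf
    simpa using hab g hg

/-- An irreducible resolvent over a field `F` defines a Galois extension of `F` with group `G`. -/
theorem exists_isGalois {F : Type*} [Field F] [Finite G] {Q : F[X]} {ρ : G → F[X]}
    (H : IsGaloisResolvent Q ρ) [hQf : Fact (Irreducible Q)] :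
    FiniteDimensional F (AdjoinRoot Q) ∧
      IsGalois F (AdjoinRoot Q) ∧
      Nonempty ((AdjoinRoot Q ≃ₐ[F] AdjoinRoot Q) ≃* G) := by
  have hQ : Irreducible Q := hQf.out
  have hroot (p : F[X]) : aeval (AdjoinRoot.root Q) p = 0 ↔ Q ∣ p := by
    rw [AdjoinRoot.aeval_eq, AdjoinRoot.mk_eq_zero]
  have hfd : FiniteDimensional F (AdjoinRoot Q) := (AdjoinRoot.powerBasis hQ.ne_zero).finite
  have hrank : Module.finrank F (AdjoinRoot Q) = Nat.card G := by
    rw [(AdjoinRoot.powerBasis hQ.ne_zero).finrank, AdjoinRoot.powerBasis_dim, H.natDegree_eq]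
  let σ (g : G) : AdjoinRoot Q →ₐ[F] AdjoinRoot Q :=
    AdjoinRoot.liftAlgHom Q (Algebra.ofId _ _) (aeval (AdjoinRoot.root Q) (ρ g)) <| by
      have := (hroot _).2 (H.dvd_comp g)
      rwa [aeval_comp] at this
  have hσ (g : G) : σ g (AdjoinRoot.root Q) = aeval (AdjoinRoot.root Q) (ρ g) := by
    simp [σ]
  let s : G →* (AdjoinRoot Q →ₐ[F] AdjoinRoot Q) :=
    { toFun := σ
      map_one' := by
        apply AdjoinRoot.algHom_ext
        have := (hroot _).2 H.dvd_one
        rw [hσ, AlgHom.one_apply]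
        simpa [sub_eq_zero] using this
      map_mul' g h := by
        apply AdjoinRoot.algHom_ext
        -- `σ g` commutes with polynomials over `F`, so it sends `ρ h (x)` to `ρ h (ρ g (x))`; hence
        -- the order in `dvd_mul`.
        have := (hroot _).2 (H.dvd_mul g h)
        rw [map_sub, sub_eq_zero, aeval_comp] at this
        rw [AlgHom.mul_apply, hσ, hσ, ← this, ← hσ g, ← aeval_algHom_apply] }
  let e : G →* (AdjoinRoot Q ≃ₐ[F] AdjoinRoot Q) :=
    (AlgEquiv.algHomUnitsEquiv F (AdjoinRoot Q)).toMonoidHom.comp s.toHomUnits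
  have he (g : G) (x : AdjoinRoot Q) : e g x = σ g x := rfl
  have hinj : Function.Injective e := by
    rw [injective_iff_map_eq_one]
    intro g hg
    by_contra hne
    have h1 : aeval (AdjoinRoot.root Q) (ρ g - X) = 0 := by
      rw [map_sub, ← hσ, ← he, hg]
      simp
    have h2 := (H.isCoprime g hne).isUnit_of_dvd' ((hroot _).1 h1) dvd_rfl
    exact hQ.not_isUnit h2
  have hle : Nat.card (AdjoinRoot Q ≃ₐ[F] AdjoinRoot Q) ≤ Nat.card G := by
    rw [← hrank, Nat.card_eq_fintype_card]
    exact AlgEquiv.card_le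
  have hcard : Nat.card (AdjoinRoot Q ≃ₐ[F] AdjoinRoot Q) = Nat.card G :=
    le_antisymm hle (Nat.card_le_card_of_injective e hinj)
  have hbij : Function.Bijective e :=
    (Nat.bijective_iff_injective_and_card e).2 ⟨hinj, hcard.symm⟩
  exact ⟨hfd, IsGalois.of_card_aut_eq_finrank F _ (hcard.trans hrank.symm),
    ⟨(MulEquiv.ofBijective e hbij).symm⟩⟩

/-- A Galois extension of fields with group `G` has a resolvent, the minimal polynomial of a
primitive element. -/
theorem exists_of_isGaloisGroup (G K L : Type*) [Group G] [Finite G] [Field K] [Field L]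
    [Algebra K L] [MulSemiringAction G L] [IsGaloisGroup G K L] :
    ∃ (Q : K[X]) (ρ : G → K[X]), IsGaloisResolvent Q ρ ∧ Irreducible Q ∧ Q.Separable := by
  have := IsGaloisGroup.isGalois G K L
  have := IsGaloisGroup.finiteDimensional G K L
  have hfaith : FaithfulSMul G L := IsGaloisGroup.faithful K
  let pb := Field.powerBasisOfFiniteOfSeparable K L
  have hint : IsIntegral K pb.gen := Algebra.IsIntegral.isIntegral _
  choose ρ hρ using fun g : G => pb.exists_eq_aeval' (g • pb.gen)
  have hsmul (g : G) (p : K[X]) : aeval (g • pb.gen) p = g • aeval pb.gen p :=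
    aeval_algHom_apply (MulSemiringAction.toAlgHom K L g) pb.gen p
  have hirr := minpoly.irreducible hint
  refine ⟨minpoly K pb.gen, ρ, ⟨minpoly.monic hint, ?_, fun g => ?_, ?_, fun g h => ?_,
    fun g hg => ?_⟩, hirr, Algebra.IsSeparable.isSeparable K pb.gen⟩
  · rw [pb.natDegree_minpoly, ← pb.finrank, IsGaloisGroup.card_eq_finrank G K L]
  · rw [minpoly.dvd_iff, aeval_comp, ← hρ, hsmul, minpoly.aeval, smul_zero]
  · rw [minpoly.dvd_iff, map_sub, ← hρ, aeval_X, one_smul, sub_self]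
  · rw [minpoly.dvd_iff, map_sub, aeval_comp, ← hρ, ← hρ, hsmul, ← hρ, mul_smul, sub_self]
  · refine (hirr.coprime_iff_not_dvd.2 fun hdvd => hg ?_).symm
    rw [minpoly.dvd_iff, map_sub, ← hρ, aeval_X, sub_eq_zero] at hdvd
    apply hfaith.eq_of_smul_eq_smul
    intro x
    obtain ⟨p, rfl⟩ := pb.exists_eq_aeval' x
    rw [← hsmul, hdvd, one_smul]

end IsGaloisResolvent

/-! ### Retract rationality and irreducibility -/

open Polynomial in
/-- If `K → A → K` is the identity for an integrally closed domain `A` with fraction field `F`,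
then the composite `K → A → F` preserves the irreducibility of monic polynomials. -/
theorem irreducible_map_of_retract {K A F : Type*} [Field K] [CommRing A] [IsDomain A]
    [IsIntegrallyClosed A] [Field F] [Algebra A F] [IsFractionRing A F]
    (i : K →+* A) (r : A →+* K) (hri : r.comp i = RingHom.id K)
    {Q : K[X]} (hQ : Q.Monic) (hirr : Irreducible Q) :
    Irreducible (Q.map ((algebraMap A F).comp i)) := by
  -- Gauss's lemma reduces to `A[X]`, where `r` carries the image of `Q` back to `Q`.
  rw [← Polynomial.map_map, ← (hQ.map i).irreducible_iff_irreducible_map_fraction_map]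
  refine (hQ.map i).irreducible_of_irreducible_map r _ ?_
  rwa [Polynomial.map_map, hri, Polynomial.map_id]

open Polynomial in
/-- A retract rational field maps to a rational function field so that monic irreducible
polynomials stay irreducible. -/
theorem IsRetractRational.exists_ringHom {k K : Type*} [Field k] [Field K] [Algebra k K]
    (h : IsRetractRational k K) :
    ∃ (n : ℕ) (ι : K →+* FractionRing (MvPolynomial (Fin n) k)),
      ∀ Q : K[X], Q.Monic → Irreducible Q → Irreducible (Q.map ι) := by
  obtain ⟨A, hA, n, f, hf, φ, ψ, hψφ⟩ := h
  let χ : MvPolynomial (Fin n) k →+* K :=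
    (A.val.toRingHom.comp ψ.toRingHom).comp (algebraMap _ (Localization.Away f))
  -- Localizing at this kernel makes `K` itself, not only `A`, a retract of the local ring `Rp`.
  let p : Ideal (MvPolynomial (Fin n) k) := RingHom.ker χ
  have hp : p.IsPrime := RingHom.ker_isPrime χ
  let Rp := Localization.AtPrime p
  have hunit (y : p.primeCompl) : IsUnit (χ y) := isUnit_iff_ne_zero.2 y.2
  let r : Rp →+* K := IsLocalization.lift hunit
  have hr (x) : r (algebraMap _ Rp x) = χ x := IsLocalization.lift_eq hunit x
  have hfp : IsUnit (algebraMap _ Rp f) := by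
    refine IsLocalization.map_units Rp (⟨f, ?_⟩ : p.primeCompl)
    have hu : IsUnit (χ f) :=
      (IsLocalization.Away.algebraMap_isUnit (S := Localization.Away f) f).map
        (A.val.toRingHom.comp ψ.toRingHom)
    exact hu.ne_zero
  let l : Localization.Away f →+* Rp := IsLocalization.Away.lift f hfp
  have hrl : r.comp l = A.val.toRingHom.comp ψ.toRingHom := by
    apply IsLocalization.ringHom_ext (Submonoid.powers f)
    refine RingHom.ext fun x => ?_
    simpa [l, χ] using hr x
  let j : A →+* Rp := l.comp φ.toRingHom
  have hrj (a : A) : r (j a) = a := by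
    have h1 := RingHom.congr_fun hrl (φ a)
    have h2 : ψ (φ a) = a := AlgHom.congr_fun hψφ a
    calc r (j a) = (r.comp l) (φ a) := rfl
      _ = ((ψ (φ a) : A) : K) := h1
      _ = a := by rw [h2]
  -- A nonunit of `Rp` lies in the maximal ideal, which `r` kills, whereas `r (j a) = a` is nonzero.
  have hjunit (a : nonZeroDivisors A) : IsUnit (j a) := by
    have h0 : r (j a) ≠ 0 := by
      rw [hrj]
      simp
    by_contra hn
    have hm : j a ∈ IsLocalRing.maximalIdeal Rp := hn
    obtain ⟨x, s, hxs⟩ := IsLocalization.exists_mk'_eq p.primeCompl (j a)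
    rw [← hxs, IsLocalization.AtPrime.mk'_mem_maximal_iff Rp p] at hm
    apply h0
    rw [← hxs, IsLocalization.lift_mk'_spec, mul_zero]
    exact hm
  let i : K →+* Rp := IsLocalization.lift hjunit
  have hri : r.comp i = RingHom.id K := by
    apply IsLocalization.ringHom_ext (nonZeroDivisors A)
    refine RingHom.ext fun a => ?_
    have hi : i (algebraMap A K a) = j a := IsLocalization.lift_eq hjunit a
    exact (congrArg r hi).trans (hrj a)
  have hle : p.primeCompl ≤ nonZeroDivisors (MvPolynomial (Fin n) k) :=
    p.primeCompl_le_nonZeroDivisors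
  have hic : IsIntegrallyClosed Rp := isIntegrallyClosed_of_isLocalization Rp p.primeCompl hle
  let F := FractionRing (MvPolynomial (Fin n) k)
  let m : Rp →+* F := IsLocalization.lift (M := p.primeCompl) (g := algebraMap _ F)
    fun y => isUnit_iff_ne_zero.2 <| by
      simpa using nonZeroDivisors.ne_zero (hle y.2)
  let _ : Algebra Rp F := m.toAlgebra
  have : IsScalarTower (MvPolynomial (Fin n) k) Rp F :=
    IsScalarTower.of_algebraMap_eq fun x => (IsLocalization.lift_eq _ x).symm
  have : IsFractionRing Rp F :=
    IsFractionRing.isFractionRing_of_isDomain_of_isLocalization p.primeCompl Rp F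
  exact ⟨n, (algebraMap Rp F).comp i, fun Q hQ hirr =>
    irreducible_map_of_retract i r hri hQ hirr⟩

/-! ### Specialization by Hilbert irreducibility -/

open Polynomial in
/-- Finitely many polynomials over the fraction field have a common denominator. -/
theorem exists_common_denominator {R F : Type*} [CommRing R] [IsDomain R] [Field F] [Algebra R F]
    [IsFractionRing R F] {S : Set F[X]} (hS : S.Finite) :
    ∃ h : R, h ≠ 0 ∧ ∀ p ∈ S, ∃ P : R[X], P.map (algebraMap R F) = C (algebraMap R F h) * p := by
  classical
  let T : Finset F := hS.toFinset.biUnion fun p => p.coeffs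
  obtain ⟨b, hb⟩ := IsLocalization.exist_integer_multiples_of_finset (nonZeroDivisors R) T
  refine ⟨b, nonZeroDivisors.ne_zero b.2, fun p hp => ?_⟩
  have hlift : C (algebraMap R F b) * p ∈ Polynomial.lifts (algebraMap R F) := by
    rw [Polynomial.lifts_iff_coeff_lifts]
    intro n
    rw [coeff_C_mul]
    by_cases h0 : p.coeff n = 0
    · exact ⟨0, by simp [h0]⟩
    · have := hb (p.coeff n) (Finset.mem_biUnion.2
        ⟨p, hS.mem_toFinset.2 hp, Polynomial.coeff_mem_coeffs h0⟩)
      rwa [Algebra.smul_def] at this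
  obtain ⟨P, hP⟩ := (Polynomial.mem_lifts _).1 hlift
  exact ⟨P, hP⟩

open Polynomial in
/-- Hilbert irreducibility specialises an irreducible separable resolvent over `k(T₁, …, Tₙ)`
to an irreducible resolvent over `k`. -/
theorem HilbertIrreducibilityHolds.exists_resolvent {k G : Type*} [Field k] [Group G] [Finite G]
    (hk : HilbertIrreducibilityHolds k) {n : ℕ}
    {Q : (FractionRing (MvPolynomial (Fin n) k))[X]}
    {ρ : G → (FractionRing (MvPolynomial (Fin n) k))[X]}
    (H : IsGaloisResolvent Q ρ) (hirr : Irreducible Q) (hsep : Q.Separable) :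
    ∃ (q : k[X]) (τ : G → k[X]), IsGaloisResolvent q τ ∧ Irreducible q := by
  let R := MvPolynomial (Fin n) k
  let F := FractionRing R
  have hbez (g : G) : ∃ a b : F[X], g ≠ 1 → a * (ρ g - X) + b * Q = 1 := by
    by_cases hg : g = 1
    · exact ⟨0, 0, fun h => absurd hg h⟩
    · obtain ⟨a, b, hab⟩ := H.isCoprime g hg
      exact ⟨a, b, fun _ => hab⟩
  choose a b hab using hbez
  -- The Bézout coefficients are included so that coprimality also holds over `R[1/h]`. Choosing `t`
  -- with `h(t) ≠ 0` then lets evaluation extend to that ring.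
  obtain ⟨h, h0, hS⟩ := exists_common_denominator (R := R) (F := F)
    (S := {Q} ∪ Set.range ρ ∪ Set.range a ∪ Set.range b)
    ((((Set.finite_singleton Q).union (Set.finite_range ρ)).union (Set.finite_range a)).union
      (Set.finite_range b))
  have h0F : algebraMap R F h ≠ 0 := by simpa using h0
  let D := Localization.Away h
  let j : D →+* F := IsLocalization.Away.lift h (isUnit_iff_ne_zero.2 h0F)
  have hjR (x : R) : j (algebraMap R D x) = algebraMap R F x := by simp [j]
  have hinj : Function.Injective j := by
    rw [injective_iff_map_eq_zero]
    intro x hx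
    obtain ⟨y, s, rfl⟩ := IsLocalization.exists_mk'_eq (Submonoid.powers h) x
    have h1 : j (IsLocalization.mk' D y s) * j (algebraMap R D s) = j (algebraMap R D y) := by
      rw [← map_mul, IsLocalization.mk'_spec]
    rw [hx, zero_mul, hjR] at h1
    have h2 : y = 0 := by simpa using h1.symm
    rw [h2, IsLocalization.mk'_zero]
  have hlift (p : F[X]) (hp : p ∈ {Q} ∪ Set.range ρ ∪ Set.range a ∪ Set.range b) :
      ∃ P : D[X], P.map j = p := by
    obtain ⟨P, hP⟩ := hS p hp
    refine ⟨C (IsLocalization.Away.invSelf h) * P.map (algebraMap R D), ?_⟩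
    have h1 : j (IsLocalization.Away.invSelf h) * algebraMap R F h = 1 := by
      rw [← hjR, ← map_mul, mul_comm, IsLocalization.Away.mul_invSelf, map_one]
    have h2 : j.comp (algebraMap R D) = algebraMap R F := RingHom.ext hjR
    rw [Polynomial.map_mul, Polynomial.map_C, Polynomial.map_map, h2, hP, ← mul_assoc, ← C_mul,
      h1, C_1, one_mul]
  obtain ⟨P, hP⟩ := hS Q (by simp)
  obtain ⟨Q', rfl⟩ := hlift Q (by simp)
  choose ρ' hρ' using fun g => hlift (ρ g) (by simp)
  choose a' ha' using fun g => hlift (a g) (by simp)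
  choose b' hb' using fun g => hlift (b g) (by simp)
  obtain rfl : (fun g => (ρ' g).map j) = ρ := funext hρ'
  have H' : IsGaloisResolvent Q' ρ' := H.of_map hinj a' b' fun g hg => by
    rw [ha', hb']
    exact hab g hg
  have hCu : IsUnit (C (algebraMap R F h)) := (isUnit_iff_ne_zero.2 h0F).map C
  have hPD : P.map (algebraMap R D) = C (algebraMap R D h) * Q' := by
    apply Polynomial.map_injective j hinj
    have h2 : j.comp (algebraMap R D) = algebraMap R F := RingHom.ext hjR
    rw [Polynomial.map_map, h2, hP, Polynomial.map_mul, Polynomial.map_C, hjR]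
  obtain ⟨t, ht, hirrt⟩ := hk n P
    (by rw [hP]; exact (irreducible_isUnit_mul hCu).2 hirr)
    (by rw [hP]; exact hsep.unit_mul hCu) h h0
  let ε : D →+* k := IsLocalization.Away.lift h (isUnit_iff_ne_zero.2 ht)
  have hεR : ε.comp (algebraMap R D) = MvPolynomial.eval t :=
    RingHom.ext fun x => by simp [ε]
  refine ⟨Q'.map ε, _, H'.map ε, ?_⟩
  have h3 : P.map (MvPolynomial.eval t) = C (MvPolynomial.eval t h) * Q'.map ε := by
    rw [← hεR, ← Polynomial.map_map, hPD, Polynomial.map_mul, Polynomial.map_C]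
    rfl
  rw [h3] at hirrt
  exact (irreducible_isUnit_mul ((isUnit_iff_ne_zero.2 ht).map C)).1 hirrt

/-! ### The Noether extension and the conclusion -/

theorem noetherAction_injective (k G : Type*) [Field k] [Group G] :
    Function.Injective (noetherAction k G) := by
  rw [injective_iff_map_eq_one]
  intro g hg
  have h := noetherAction_X k G g 1
  rw [hg, AlgEquiv.one_apply] at h
  have h' := MvPolynomial.X_injective (IsFractionRing.injective _ _ h)
  simpa using h'.symm

theorem mainTheorem6 (k : Type u) [Field k] [Infinite k]
    (hk : HilbertIrreducibilityHolds k)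
    (G : Type v) [Group G] [Finite G]
    (hG : IsRetractRational k (noetherField k G)) :
    ∃ (K : Type u) (_ : Field K) (_ : Algebra k K),
      FiniteDimensional k K ∧ IsGalois k K ∧ Nonempty ((K ≃ₐ[k] K) ≃* G) := by
  let N := (noetherAction k G).range
  let e : G ≃* N := MonoidHom.ofInjective (noetherAction_injective k G)
  have : Finite N := Finite.of_equiv G e.toEquiv
  have : IsGaloisGroup N (noetherField k G) (FractionRing (MvPolynomial G k)) :=
    { faithful := inferInstance
      commutes := ⟨fun g x y => by
        rw [Algebra.smul_def, Algebra.smul_def, smul_mul']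
        congr 1
        exact x.2 g⟩
      isInvariant := ⟨fun y hy => ⟨⟨y, hy⟩, rfl⟩⟩ }
  obtain ⟨Q, ρ, H, hirr, hsep⟩ := IsGaloisResolvent.exists_of_isGaloisGroup N
    (noetherField k G) (FractionRing (MvPolynomial G k))
  obtain ⟨n, ι, hι⟩ := hG.exists_ringHom
  obtain ⟨q, τ, Hq, hq⟩ := hk.exists_resolvent (H.map ι) (hι Q H.monic hirr) hsep.map
  have : Fact (Irreducible q) := ⟨hq⟩
  obtain ⟨hfd, hgal, ⟨E⟩⟩ := Hq.exists_isGalois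
  exact ⟨AdjoinRoot q, inferInstance, inferInstance, hfd, hgal, ⟨E.trans e.symm⟩⟩
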